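/- Let $d\ge 1$. There is a constant $C>0$, depending only on $d$, with the following property. Let $\mathcal D$ be a system of dyadic cubes in $\mathbb R^d$, that is, for some $s>0$, a collection of half-open cubes $\prod_{i=1}^d[a_i,a_i+\ell)$ with side lengths $\ell\in\{s2^k:k\in\mathbb Z\}$ such that for each $k\in\mathbb Z$ the cubes of side length $s2^k$ partition $\mathbb R^d$ and any two cubes of $\mathcal D$ are either disjoint or nested. Let $U\subseteq\mathbb R^d$ be open, bounded and of finite perimeter, i.e. the distributional gradient $D\chi_U$ of its characteristic function is an $\mathbb R^d$-valued Borel measure of finite total variation, and let $|D\chi_U|$ be its total variation measure. Then there is an at most countable (possibly finite or empty) family $\{Q_j\}_{j}\subseteq\mathcal D$ of pairwise disjoint cubes covering $U$ such that $$\chi_U=\sum_{j}\chi_{U\cap Q_j}\quad\text{pointwise on }\mathbb R^d$$ and $$\ell(Q_j)^{d-1}\le C\,|D\chi_U|(Q_j)\quad\text{for every } j,$$ where $\ell(Q)$ denotes the side length of $Q$. -/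

import Mathlib

open MeasureTheory Set
open scoped ContDiff

/-- A half-open cube `∏ i, [a i, a i + ℓ)` in `ℝ^d` with sides parallel to the axes and side length
`ℓ > 0`. -/
structure HalfOpenCube (d : ℕ) where
  /-- the lower corner `a` -/
  corner : EuclideanSpace ℝ (Fin d)
  /-- the side length `ℓ` -/
  side : ℝ
  side_pos : 0 < side

/-- The points of a cube. -/
def HalfOpenCube.toSet {d : ℕ} (Q : HalfOpenCube d) : Set (EuclideanSpace ℝ (Fin d)) :=
  {x | ∀ i, Q.corner i ≤ x i ∧ x i < Q.corner i + Q.side}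

/-- `𝒟` is a dyadic system with base scale `s > 0`: its cubes have side lengths `s * 2 ^ k`,
`k ∈ ℤ`; for each `k` the cubes of side length `s * 2 ^ k` partition `ℝ^d`; and any two cubes of
`𝒟` are either disjoint or nested. (The standard dyadic cubes `2 ^ k • (m + [0,1)^d)`, `m ∈ ℤ^d`,
have `s = 1`.) -/
structure IsDyadicSystem {d : ℕ} (s : ℝ) (𝒟 : Set (HalfOpenCube d)) : Prop where
  scale_pos : 0 < s
  side_eq : ∀ Q ∈ 𝒟, ∃ k : ℤ, Q.side = s * 2 ^ k
  partition : ∀ (k : ℤ) (x : EuclideanSpace ℝ (Fin d)),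
    ∃! Q : HalfOpenCube d, Q ∈ 𝒟 ∧ Q.side = s * 2 ^ k ∧ x ∈ Q.toSet
  nested : ∀ Q ∈ 𝒟, ∀ R ∈ 𝒟,
    Disjoint Q.toSet R.toSet ∨ Q.toSet ⊆ R.toSet ∨ R.toSet ⊆ Q.toSet

/-- The distributional gradient of the locally integrable function `u` is the `ℝ^d`-valued Borel
measure `μ` of finite total variation: `∫ u ∇φ dx = - ∫ φ dμ` for all `φ ∈ C_c^∞(ℝ^d)`. -/
structure IsDistribGradient {d : ℕ} (u : EuclideanSpace ℝ (Fin d) → ℝ)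
    (μ : VectorMeasure (EuclideanSpace ℝ (Fin d)) (EuclideanSpace ℝ (Fin d))) : Prop where
  locallyIntegrable : LocallyIntegrable u volume
  finite_variation : IsFiniteMeasure μ.variation
  integral_eq : ∀ φ : EuclideanSpace ℝ (Fin d) → ℝ, ContDiff ℝ ∞ φ → HasCompactSupport φ →
    ∫ x, u x • gradient φ x = -VectorMeasure.integral μ φ (ContinuousLinearMap.lsmul ℝ ℝ)

/-! Fix `x ∈ U`. Small dyadic cubes around `x` lie in the open set `U`, while large ones meet the
bounded set `U` in a small proportion. At the largest scale where `U` fills more than half of the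
cube, pass to the parent: its density lies in `[2^{-(d+1)}, 1/2]`. The maximal cubes with such a
density are disjoint and cover `U`.

On such a cube the perimeter bound is a relative isoperimetric inequality. Moving `U ∩ Q` by `h`
sends mass at most `|Dχ|(Q) ‖h‖` into `Q \ U`; integrating over `h` bounds `|U ∩ Q| |Q \ U|`
(`measure_inter_mul_measure_diff_le`). Segments stay in the convex set `Q`, so only the variation on
the half-open cube itself is charged. -/

/-! ### Perimeter controls translations -/

theorem norm_vectorMeasure_integral_le_variation {d : ℕ}
    (μ : VectorMeasure (EuclideanSpace ℝ (Fin d)) (EuclideanSpace ℝ (Fin d)))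
    [IsFiniteMeasure μ.variation] {φ : EuclideanSpace ℝ (Fin d) → ℝ} (hφ : Continuous φ)
    (hφ1 : ∀ x, |φ x| ≤ 1) {V : Set (EuclideanSpace ℝ (Fin d))} (hV : MeasurableSet V)
    (hφV : ∀ x, φ x ≠ 0 → x ∈ V) :
    ‖VectorMeasure.integral μ φ (ContinuousLinearMap.lsmul ℝ ℝ)‖ ≤ μ.variation.real V := by
  have h0 : (0 : ℝ) ≤ ∫ x, ‖φ x‖ ∂μ.variation := integral_nonneg fun _ => norm_nonneg _
  have h1 : ‖VectorMeasure.integral μ φ (ContinuousLinearMap.lsmul ℝ ℝ)‖ ≤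
      ∫ x, ‖φ x‖ ∂μ.variation := by
    refine VectorMeasure.norm_integral_le_integral_norm.trans ?_
    exact mul_le_of_le_one_left h0 ContinuousLinearMap.opNorm_lsmul_le
  refine h1.trans ?_
  rw [← integral_indicator_one hV]
  refine integral_mono ?_ ?_ fun x => ?_
  · exact Integrable.of_bound hφ.norm.aestronglyMeasurable 1
      (Filter.Eventually.of_forall fun x => by simpa using hφ1 x)
  · exact (integrable_const (1 : ℝ)).indicator hV
  · by_cases hx : x ∈ V
    · simpa [hx] using hφ1 x
    · have : φ x = 0 := by_contra fun h => hx (hφV x h)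
      simp [hx, this]

/-- The `t`-derivative of `∫_U φ(x - t h)` is, by the definition of the distributional gradient, the
pairing of `h` with `∫ φ(x - t h) dμ`. The translates with `t ∈ [0,1]` vanish outside `V`, so the
mean value inequality applies. -/
theorem abs_setIntegral_translate_sub_le {d : ℕ} {U : Set (EuclideanSpace ℝ (Fin d))}
    (hU : IsOpen U) (hUb : Bornology.IsBounded U)
    {μ : VectorMeasure (EuclideanSpace ℝ (Fin d)) (EuclideanSpace ℝ (Fin d))}
    (hμ : IsDistribGradient (U.indicator (fun _ => (1 : ℝ))) μ)
    {φ : EuclideanSpace ℝ (Fin d) → ℝ} (hφ : ContDiff ℝ ∞ φ) (hφc : HasCompactSupport φ)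
    (hφ1 : ∀ x, |φ x| ≤ 1) (h : EuclideanSpace ℝ (Fin d))
    {V : Set (EuclideanSpace ℝ (Fin d))} (hV : MeasurableSet V)
    (hφV : ∀ x, φ x ≠ 0 → ∀ t ∈ Icc (0 : ℝ) 1, x + t • h ∈ V) :
    |(∫ x in U, φ (x - h)) - ∫ x in U, φ x| ≤ μ.variation.real V * ‖h‖ := by
  have := hμ.finite_variation
  have hfin : IsFiniteMeasure (volume.restrict U) :=
    isFiniteMeasure_restrict.2 hUb.measure_lt_top.ne
  have hd : ∀ x, DifferentiableAt ℝ φ x := fun x => hφ.differentiable (by simp) x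
  have hdc : Continuous (fderiv ℝ φ) := hφ.continuous_fderiv (by simp)
  obtain ⟨M, hM⟩ := (hφc.fderiv (𝕜 := ℝ)).exists_bound_of_continuous hdc
  have hderiv : ∀ t : ℝ, HasDerivAt (fun t : ℝ => ∫ x in U, φ (x - t • h))
      (∫ x in U, -(fderiv ℝ φ (x - t • h) h)) t := by
    intro t
    refine (hasDerivAt_integral_of_dominated_loc_of_deriv_le (s := univ)
      (F := fun t x => φ (x - t • h)) (F' := fun t x => -(fderiv ℝ φ (x - t • h) h))
      (bound := fun _ => M * ‖h‖) Filter.univ_mem ?_ ?_ ?_ ?_ ?_ ?_).2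
    · exact Filter.Eventually.of_forall fun t =>
        (hφ.continuous.comp (by fun_prop)).aestronglyMeasurable
    · exact Integrable.of_bound (hφ.continuous.comp (by fun_prop)).aestronglyMeasurable 1
        (Filter.Eventually.of_forall fun x => hφ1 _)
    · exact Continuous.aestronglyMeasurable (by fun_prop)
    · refine Filter.Eventually.of_forall fun x t _ => ?_
      rw [norm_neg]
      exact (ContinuousLinearMap.le_opNorm _ _).trans (by gcongr; exact hM _)
    · exact integrable_const _
    · refine Filter.Eventually.of_forall fun x t _ => ?_
      have h1 : HasDerivAt (fun t : ℝ => x - t • h) (-h) t := by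
        simpa using ((hasDerivAt_id t).smul_const h).const_sub x
      have := (hd (x - t • h)).hasFDerivAt.comp_hasDerivAt t h1
      simpa [Function.comp_def] using this
  have hbound : ∀ t ∈ Ico (0 : ℝ) 1,
      ‖∫ x in U, -(fderiv ℝ φ (x - t • h) h)‖ ≤ μ.variation.real V * ‖h‖ := by
    intro t ht
    set ψ : EuclideanSpace ℝ (Fin d) → ℝ := fun x => φ (x - t • h) with hψdef
    have hψ : ContDiff ℝ ∞ ψ := hφ.comp (contDiff_id.sub contDiff_const)
    have hψc : HasCompactSupport ψ := by
      simpa [hψdef, Function.comp_def, sub_eq_add_neg] using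
        hφc.comp_homeomorph (Homeomorph.addRight (-(t • h)))
    have hψd : ∀ x, fderiv ℝ ψ x = fderiv ℝ φ (x - t • h) := fun x =>
      fderiv_comp_sub (𝕜 := ℝ) (f := φ) (x := x) (t • h)
    have hgc : Continuous (gradient ψ) :=
      (InnerProductSpace.toDual ℝ _).symm.continuous.comp (hψ.continuous_fderiv (by simp))
    have hgb : ∀ x, ‖gradient ψ x‖ ≤ M := fun x => by
      simpa [gradient, hψd] using hM (x - t • h)
    have hgi : IntegrableOn (gradient ψ) U :=
      Integrable.of_bound hgc.aestronglyMeasurable M (Filter.Eventually.of_forall hgb)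
    have key := hμ.integral_eq ψ hψ hψc
    have e1 : ∫ x, U.indicator (fun _ => (1 : ℝ)) x • gradient ψ x = ∫ x in U, gradient ψ x := by
      rw [← integral_indicator hU.measurableSet]
      congr 1 with x : 1
      by_cases hx : x ∈ U <;> simp [hx]
    rw [e1] at key
    have e2 : ∫ x in U, -(fderiv ℝ φ (x - t • h) h) = -inner ℝ h (∫ x in U, gradient ψ x) := by
      rw [← integral_inner hgi, integral_neg]
      simp [inner_gradient_right, hψd]
    rw [e2, key, norm_neg]
    refine (norm_inner_le_norm _ _).trans ?_
    rw [mul_comm, norm_neg]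
    gcongr
    refine norm_vectorMeasure_integral_le_variation μ hψ.continuous (fun x => hφ1 _) hV ?_
    intro x hx
    simpa using hφV _ hx t (Ico_subset_Icc_self ht)
  simpa using norm_image_sub_le_of_norm_deriv_le_segment_01'
    (fun t _ => (hderiv t).hasDerivWithinAt) hbound

theorem exists_smooth_bump_of_isCompact_subset_isOpen {d : ℕ}
    {K W : Set (EuclideanSpace ℝ (Fin d))} (hK : IsCompact K) (hW : IsOpen W)
    (hWb : Bornology.IsBounded W) (hKW : K ⊆ W) :
    ∃ φ : EuclideanSpace ℝ (Fin d) → ℝ, ContDiff ℝ ∞ φ ∧ HasCompactSupport φ ∧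
      (∀ x, φ x ∈ Icc (0 : ℝ) 1) ∧ (∀ x ∈ K, φ x = 1) ∧ ∀ x, φ x ≠ 0 → x ∈ W := by
  obtain ⟨f, h0, h1, h01⟩ := exists_contMDiffMap_zero_one_of_isClosed
    (n := (⊤ : ℕ∞)) (modelWithCornersSelf ℝ (EuclideanSpace ℝ (Fin d)))
    hW.isClosed_compl hK.isClosed (disjoint_left.2 fun x hx hx' => hx (hKW hx'))
  have hs : ∀ x, f x ≠ 0 → x ∈ W := fun x hx => by_contra fun h => hx (h0 h)
  refine ⟨f, f.contMDiff.contDiff, ?_, h01, h1, hs⟩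
  exact HasCompactSupport.intro' hWb.isCompact_closure isClosed_closure
    fun x hx => by_contra fun h => hx (subset_closure (hs x h))

/-- Test with a smooth `φ ≈ χ_K`: `∫_U φ ≥ |K|`, whereas `∫_U φ(x - h) ≈ 0` since `K + h` misses
`U`. -/
theorem measureReal_compact_le_of_translate {d : ℕ} {U : Set (EuclideanSpace ℝ (Fin d))}
    (hU : IsOpen U) (hUb : Bornology.IsBounded U)
    {μ : VectorMeasure (EuclideanSpace ℝ (Fin d)) (EuclideanSpace ℝ (Fin d))}
    (hμ : IsDistribGradient (U.indicator (fun _ => (1 : ℝ))) μ)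
    {K Q : Set (EuclideanSpace ℝ (Fin d))} (hK : IsCompact K) (hKU : K ⊆ U)
    (h : EuclideanSpace ℝ (Fin d)) (hKh : ∀ x ∈ K, x + h ∉ U)
    (hKQ : ∀ x ∈ K, ∀ t ∈ Icc (0 : ℝ) 1, x + t • h ∈ Q) :
    volume.real K ≤ μ.variation.real Q * ‖h‖ := by
  have := hμ.finite_variation
  have hfin : IsFiniteMeasure (volume.restrict U) :=
    isFiniteMeasure_restrict.2 hUb.measure_lt_top.ne
  have hmain : ∀ ε : ℝ, 0 < ε → volume.real K ≤ (μ.variation.real Q + ε) * ‖h‖ + ε := by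
    intro ε hε
    -- The set swept by `K` is a compact part of `Q`; outer regularity gives an open `V` around it,
    -- with room for a bump slightly wider than `K`.
    set L := (fun p : ℝ × EuclideanSpace ℝ (Fin d) => p.2 + p.1 • h) '' (Icc (0 : ℝ) 1 ×ˢ K)
    have hL : IsCompact L := (isCompact_Icc.prod hK).image (by fun_prop)
    have hLQ : L ⊆ Q := by
      rintro _ ⟨⟨t, x⟩, ⟨ht, hx⟩, rfl⟩
      exact hKQ x hx t ht
    obtain ⟨V, hLV, hVo, hV⟩ := L.exists_isOpen_lt_add (μ := μ.variation) (measure_ne_top _ _)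
      (ε := ENNReal.ofReal ε) (by simpa using hε)
    have hVreal : μ.variation.real V ≤ μ.variation.real Q + ε := by
      have h1 : μ.variation V ≤ μ.variation Q + ENNReal.ofReal ε :=
        hV.le.trans (by gcongr)
      have := ENNReal.toReal_mono (by finiteness) h1
      rwa [ENNReal.toReal_add (by finiteness) (by finiteness), ENNReal.toReal_ofReal hε.le] at this
    obtain ⟨δ, hδ, hδV⟩ := hL.exists_thickening_subset_open hVo hLV
    obtain ⟨W', hKW', hW'o, -, hW'⟩ := hK.measurableSet.exists_isOpen_sdiff_lt
      (μ := volume) hK.measure_lt_top.ne (ε := ENNReal.ofReal ε) (by simpa using hε)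
    set W := Metric.thickening δ K ∩ W'
    have hWb : Bornology.IsBounded W := (hK.isBounded.thickening).subset inter_subset_left
    have hKW : K ⊆ W := subset_inter (Metric.self_subset_thickening hδ K) hKW'
    obtain ⟨φ, hφ, hφc, hφ01, hφK, hφW⟩ := exists_smooth_bump_of_isCompact_subset_isOpen hK
      (Metric.isOpen_thickening.inter hW'o) hWb hKW
    have hφ1 : ∀ x, |φ x| ≤ 1 := fun x => abs_le.2 ⟨by linarith [(hφ01 x).1], (hφ01 x).2⟩
    have hφi : ∀ v, IntegrableOn (fun x => φ (x - v)) U := fun v =>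
      Integrable.of_bound (hφ.continuous.comp (by fun_prop)).aestronglyMeasurable 1
        (Filter.Eventually.of_forall fun x => hφ1 _)
    have hT := abs_setIntegral_translate_sub_le hU hUb hμ hφ hφc hφ1 h hVo.measurableSet (by
      intro x hx t ht
      obtain ⟨y, hy, hxy⟩ := Metric.mem_thickening_iff.1 (hφW x hx).1
      refine hδV (Metric.mem_thickening_iff.2 ⟨y + t • h, ⟨(t, y), ⟨ht, hy⟩, rfl⟩, ?_⟩)
      simpa using hxy)
    have hlow : volume.real K ≤ ∫ x in U, φ x := by
      have : volume.real K = ∫ x in K, φ x := by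
        rw [setIntegral_congr_fun hK.measurableSet hφK]; simp
      rw [this]
      exact setIntegral_mono_set (by simpa using hφi 0)
        (Filter.Eventually.of_forall fun x => (hφ01 x).1) hKU.eventuallyLE
    have hup : ∫ x in U, φ (x - h) ≤ ε := by
      -- On `U`, the translated bump can only live on the translate of the thin shell `W' \ K`.
      set S := (fun x => x - h) ⁻¹' (W' \ K)
      have hSm : MeasurableSet S :=
        (measurable_id.sub_const h) (hW'o.measurableSet.diff hK.measurableSet)
      have hSv : volume S < ENNReal.ofReal ε := by
        simp only [S, sub_eq_add_neg]
        rwa [measure_preimage_add_right]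
      calc ∫ x in U, φ (x - h) ≤ ∫ x in U, S.indicator 1 x := by
            refine setIntegral_mono_on (hφi h) ((integrable_const (1 : ℝ)).indicator hSm)
              hU.measurableSet fun x hx => ?_
            by_cases hxS : x ∈ S
            · simpa [hxS] using (hφ01 _).2
            · have : φ (x - h) = 0 := by
                by_contra h0
                refine hxS ⟨(hφW _ h0).2, fun hxK => hKh _ hxK (by simpa using hx)⟩
              simp [hxS, this]
        _ = (volume.restrict U).real S := integral_indicator_one hSm
        _ ≤ ε := by
            refine ENNReal.toReal_le_of_le_ofReal hε.le ?_
            exact (Measure.restrict_apply_le _ _).trans hSv.le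
    have := (abs_le.1 hT).1
    have h2 : μ.variation.real V * ‖h‖ ≤ (μ.variation.real Q + ε) * ‖h‖ := by gcongr
    linarith
  refine le_of_forall_pos_le_add fun ε hε => ?_
  have h1 : 0 < 1 + ‖h‖ := by positivity
  have := hmain (ε / (1 + ‖h‖)) (by positivity)
  have h2 : ε / (1 + ‖h‖) * (1 + ‖h‖) = ε := by field_simp
  linarith

theorem measure_le_of_translate {d : ℕ} {U : Set (EuclideanSpace ℝ (Fin d))}
    (hU : IsOpen U) (hUb : Bornology.IsBounded U)
    {μ : VectorMeasure (EuclideanSpace ℝ (Fin d)) (EuclideanSpace ℝ (Fin d))}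
    (hμ : IsDistribGradient (U.indicator (fun _ => (1 : ℝ))) μ)
    {Q : Set (EuclideanSpace ℝ (Fin d))} (hQ : Convex ℝ Q) (hQm : MeasurableSet Q)
    (h : EuclideanSpace ℝ (Fin d)) :
    volume ((U ∩ Q) ∩ (fun x => x + h) ⁻¹' (Q \ U)) ≤
      ENNReal.ofReal (μ.variation.real Q * ‖h‖) := by
  have hm : MeasurableSet ((U ∩ Q) ∩ (fun x => x + h) ⁻¹' (Q \ U)) :=
    (hU.measurableSet.inter hQm).inter ((measurable_id.add_const h) (hQm.diff hU.measurableSet))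
  rw [hm.measure_eq_iSup_isCompact]
  refine iSup₂_le fun K hK => iSup_le fun hKc => ?_
  rw [← ofReal_measureReal hKc.measure_lt_top.ne]
  refine ENNReal.ofReal_le_ofReal (measureReal_compact_le_of_translate hU hUb hμ hKc
    (fun x hx => (hK hx).1.1) h (fun x hx => (hK hx).2.2) fun x hx t ht => ?_)
  have := hQ.add_smul_sub_mem (hK hx).1.2 (hK hx).2.1 ht
  simpa using this

/-! ### Relative isoperimetric inequality by averaging over translations -/

theorem lintegral_measure_inter_preimage_add {d : ℕ} {A B : Set (EuclideanSpace ℝ (Fin d))}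
    (hA : MeasurableSet A) (hB : MeasurableSet B) :
    ∫⁻ h, volume (A ∩ (fun x => x + h) ⁻¹' B) = volume A * volume B := by
  have hm : Measurable fun p : EuclideanSpace ℝ (Fin d) × EuclideanSpace ℝ (Fin d) =>
      A.indicator (1 : EuclideanSpace ℝ (Fin d) → ENNReal) p.2 *
        B.indicator (1 : EuclideanSpace ℝ (Fin d) → ENNReal) (p.2 + p.1) :=
    ((measurable_one.indicator hA).comp measurable_snd).mul
      ((measurable_one.indicator hB).comp (measurable_snd.add measurable_fst))
  calc ∫⁻ h, volume (A ∩ (fun x => x + h) ⁻¹' B)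
      = ∫⁻ h, ∫⁻ x, A.indicator (1 : EuclideanSpace ℝ (Fin d) → ENNReal) x *
          B.indicator (1 : EuclideanSpace ℝ (Fin d) → ENNReal) (x + h) := by
        congr 1 with h
        rw [← lintegral_indicator_one (hA.inter ((measurable_add_const h) hB))]
        congr 1 with x
        by_cases hx : x ∈ A <;> by_cases hx' : x + h ∈ B <;> simp [hx, hx']
    _ = ∫⁻ x, ∫⁻ h, A.indicator (1 : EuclideanSpace ℝ (Fin d) → ENNReal) x *
          B.indicator (1 : EuclideanSpace ℝ (Fin d) → ENNReal) (x + h) :=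
        lintegral_lintegral_swap hm.aemeasurable
    _ = ∫⁻ x, A.indicator (1 : EuclideanSpace ℝ (Fin d) → ENNReal) x * volume B := by
        congr 1 with x
        have hBm : Measurable (B.indicator (1 : EuclideanSpace ℝ (Fin d) → ENNReal)) :=
          measurable_one.indicator hB
        rw [lintegral_const_mul _ (by fun_prop), lintegral_add_left_eq_self _ x,
          lintegral_indicator_one hB]
    _ = volume A * volume B := by
        rw [lintegral_mul_const _ (measurable_one.indicator hA), lintegral_indicator_one hA]

/-- Integrate the translation bound over `h`; vectors longer than `r` carry no point of `Q` into
`Q`. -/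
theorem measure_inter_mul_measure_diff_le {d : ℕ} {U : Set (EuclideanSpace ℝ (Fin d))}
    (hU : IsOpen U) (hUb : Bornology.IsBounded U)
    {μ : VectorMeasure (EuclideanSpace ℝ (Fin d)) (EuclideanSpace ℝ (Fin d))}
    (hμ : IsDistribGradient (U.indicator (fun _ => (1 : ℝ))) μ)
    {Q : Set (EuclideanSpace ℝ (Fin d))} (hQ : Convex ℝ Q) (hQm : MeasurableSet Q)
    {r : ℝ} (hr : ∀ x ∈ Q, ∀ y ∈ Q, dist x y ≤ r) :
    volume (U ∩ Q) * volume (Q \ U) ≤ ENNReal.ofReal (μ.variation.real Q * r) *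
      volume (Metric.closedBall (0 : EuclideanSpace ℝ (Fin d)) r) := by
  rw [← lintegral_measure_inter_preimage_add (hU.measurableSet.inter hQm)
    (hQm.diff hU.measurableSet), ← setLIntegral_const, ← lintegral_indicator
    Metric.isClosed_closedBall.measurableSet]
  refine lintegral_mono fun h => ?_
  by_cases hh : h ∈ Metric.closedBall (0 : EuclideanSpace ℝ (Fin d)) r
  · rw [indicator_of_mem hh]
    refine (measure_le_of_translate hU hUb hμ hQ hQm h).trans (ENNReal.ofReal_le_ofReal ?_)
    have : ‖h‖ ≤ r := by simpa using hh
    gcongr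
  · have : (U ∩ Q) ∩ (fun x => x + h) ⁻¹' (Q \ U) = ∅ := by
      refine eq_empty_of_forall_notMem fun x hx => hh ?_
      simpa [dist_eq_norm] using hr _ hx.2.1 _ hx.1.2
    rw [this, measure_empty]
    exact zero_le


/-! ### Geometry of cubes -/

namespace HalfOpenCube

variable {d : ℕ} (Q : HalfOpenCube d)

theorem toSet_eq_preimage : Q.toSet = WithLp.ofLp ⁻¹'
    (univ.pi fun i => Ico (Q.corner i) (Q.corner i + Q.side)) := by
  ext x
  simp [toSet]

theorem measurableSet_toSet : MeasurableSet Q.toSet := by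
  rw [toSet_eq_preimage]
  exact (PiLp.volume_preserving_ofLp (Fin d)).measurable
    (MeasurableSet.univ_pi fun _ => measurableSet_Ico)

theorem convex_toSet : Convex ℝ Q.toSet := by
  rw [toSet_eq_preimage]
  exact (convex_pi fun i _ => convex_Ico _ _).linear_preimage
    (WithLp.linearEquiv 2 ℝ (Fin d → ℝ)).toLinearMap

theorem volume_toSet : volume Q.toSet = ENNReal.ofReal (Q.side ^ d) := by
  rw [toSet_eq_preimage, (PiLp.volume_preserving_ofLp (Fin d)).measure_preimage
    (MeasurableSet.univ_pi fun _ => measurableSet_Ico).nullMeasurableSet, volume_pi_pi]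
  simp [ENNReal.ofReal_pow Q.side_pos.le]

theorem volumeReal_toSet : volume.real Q.toSet = Q.side ^ d := by
  rw [measureReal_def, volume_toSet, ENNReal.toReal_ofReal (pow_nonneg Q.side_pos.le d)]

theorem volume_toSet_ne_top : volume Q.toSet ≠ ⊤ := by
  rw [volume_toSet]
  exact ENNReal.ofReal_ne_top

theorem dist_le {x y : EuclideanSpace ℝ (Fin d)} (hx : x ∈ Q.toSet) (hy : y ∈ Q.toSet) :
    dist x y ≤ √d * Q.side := by
  have hs := Q.side_pos
  rw [EuclideanSpace.dist_eq]
  refine Real.sqrt_le_iff.2 ⟨by positivity, ?_⟩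
  rw [mul_pow, Real.sq_sqrt (by positivity)]
  calc ∑ i, dist (x i) (y i) ^ 2 ≤ ∑ _i : Fin d, Q.side ^ 2 := by
        refine Finset.sum_le_sum fun i _ => ?_
        have : dist (x i) (y i) ≤ Q.side := by
          rw [Real.dist_eq, abs_le]
          constructor <;> linarith [(hx i).1, (hx i).2, (hy i).1, (hy i).2]
        gcongr
    _ = d * Q.side ^ 2 := by simp

variable {Q}

theorem side_le_side_of_subset (hd : d ≠ 0) {R : HalfOpenCube d} (h : Q.toSet ⊆ R.toSet) :
    Q.side ≤ R.side := by
  have := measureReal_mono (μ := volume) h R.volume_toSet_ne_top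
  rw [volumeReal_toSet, volumeReal_toSet] at this
  exact (pow_le_pow_iff_left₀ Q.side_pos.le R.side_pos.le hd).1 this

/-- Ensures that a largest admissible scale exists. -/
theorem side_le_max_of_pow_le (hd : d ≠ 0) {U : Set (EuclideanSpace ℝ (Fin d))}
    (hU : Bornology.IsBounded U) (h : Q.side ^ d ≤ 2 ^ (d + 1) * volume.real (U ∩ Q.toSet)) :
    Q.side ≤ max 1 (2 ^ (d + 1) * volume.real U) := by
  rcases le_total Q.side 1 with h1 | h1
  · exact h1.trans (le_max_left _ _)
  · refine (le_self_pow₀ h1 hd).trans (h.trans (le_trans ?_ (le_max_right _ _)))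
    have := measureReal_mono (μ := volume) (inter_subset_left (s := U) (t := Q.toSet))
      hU.measure_lt_top.ne
    gcongr

/-- Both `|U ∩ Q|` and `|Q \ U|` are comparable to `ℓ^d`, so the isoperimetric inequality with `r =
√d ℓ` reads `ℓ^{2d} ≲ |Dχ|(Q) ℓ^{d+1}`. -/
theorem side_pow_le_variation (hd : 1 ≤ d) {U : Set (EuclideanSpace ℝ (Fin d))}
    (hU : IsOpen U) (hUb : Bornology.IsBounded U)
    {μ : VectorMeasure (EuclideanSpace ℝ (Fin d)) (EuclideanSpace ℝ (Fin d))}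
    (hμ : IsDistribGradient (U.indicator (fun _ => (1 : ℝ))) μ)
    (hlow : Q.side ^ d ≤ 2 ^ (d + 1) * volume.real (U ∩ Q.toSet))
    (hup : 2 * volume.real (U ∩ Q.toSet) ≤ Q.side ^ d) :
    Q.side ^ (d - 1) ≤ (2 ^ (d + 2) * √d ^ (d + 1) *
      volume.real (Metric.ball (0 : EuclideanSpace ℝ (Fin d)) 1)) *
        μ.variation.real Q.toSet := by
  have hs := Q.side_pos
  have hr : 0 ≤ √d * Q.side := by positivity
  have h1 := measure_inter_mul_measure_diff_le hU hUb hμ Q.convex_toSet Q.measurableSet_toSet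
    (r := √d * Q.side) fun x hx y hy => Q.dist_le hx hy
  rw [Measure.addHaar_closedBall _ _ hr, finrank_euclideanSpace_fin] at h1
  have h2 := ENNReal.toReal_mono (by finiteness) h1
  rw [ENNReal.toReal_mul, ENNReal.toReal_mul, ENNReal.toReal_mul,
    ENNReal.toReal_ofReal (by positivity), ENNReal.toReal_ofReal (by positivity)] at h2
  simp only [← measureReal_def] at h2
  have h3 : volume.real (U ∩ Q.toSet) + volume.real (Q.toSet \ U) = Q.side ^ d := by
    rw [← Q.volumeReal_toSet, inter_comm]
    exact measureReal_inter_add_sdiff hU.measurableSet Q.volume_toSet_ne_top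
  set a := volume.real (U ∩ Q.toSet)
  set b := volume.real (Q.toSet \ U)
  set v := μ.variation.real Q.toSet
  set w := volume.real (Metric.ball (0 : EuclideanSpace ℝ (Fin d)) 1)
  have hb : Q.side ^ d ≤ 2 * b := by linarith
  have h4 : Q.side ^ d * Q.side ^ d ≤ (2 ^ (d + 1) * a) * (2 * b) := by gcongr
  have h5 : Q.side ^ d * Q.side ^ d = Q.side ^ (d - 1) * Q.side ^ (d + 1) := by
    rw [← pow_add, ← pow_add]
    congr 1
    omega
  have h6 : Q.side ^ (d - 1) * Q.side ^ (d + 1) ≤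
      (2 ^ (d + 2) * √d ^ (d + 1) * w * v) * Q.side ^ (d + 1) := by
    rw [← h5]
    calc Q.side ^ d * Q.side ^ d ≤ (2 ^ (d + 1) * a) * (2 * b) := h4
      _ = 2 ^ (d + 2) * (a * b) := by ring
      _ ≤ 2 ^ (d + 2) * (v * (√d * Q.side) * ((√d * Q.side) ^ d * w)) := by gcongr
      _ = _ := by rw [mul_pow]; ring
  exact le_of_mul_le_mul_right h6 (by positivity)

end HalfOpenCube

/-! ### Stopping scale in a dyadic system -/

namespace IsDyadicSystem

variable {d : ℕ} {s : ℝ} {𝒟 : Set (HalfOpenCube d)}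

theorem eq_of_mem_of_side_eq (h𝒟 : IsDyadicSystem s 𝒟) {Q R : HalfOpenCube d} (hQ : Q ∈ 𝒟)
    (hR : R ∈ 𝒟) (hside : Q.side = R.side) {x : EuclideanSpace ℝ (Fin d)} (hxQ : x ∈ Q.toSet)
    (hxR : x ∈ R.toSet) : Q = R := by
  obtain ⟨k, hk⟩ := h𝒟.side_eq R hR
  exact (h𝒟.partition k x).unique ⟨hQ, hside.trans hk, hxQ⟩ ⟨hR, hk, hxR⟩

theorem exists_forall_scale_le (h𝒟 : IsDyadicSystem s 𝒟) (B : ℝ) :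
    ∃ N : ℤ, ∀ k : ℤ, s * 2 ^ k ≤ B → k ≤ N := by
  have hs := h𝒟.scale_pos
  obtain ⟨n, hn⟩ := pow_unbounded_of_one_lt (B / s) (one_lt_two)
  refine ⟨n, fun k hk => le_of_not_gt fun hnk => ?_⟩
  have h1 : (2 : ℝ) ^ n ≤ 2 ^ k := by
    rw [← zpow_natCast]
    exact zpow_le_zpow_right₀ one_le_two hnk.le
  rw [div_lt_iff₀ hs] at hn
  nlinarith

theorem exists_scale_lt (h𝒟 : IsDyadicSystem s 𝒟) {ρ : ℝ} (hρ : 0 < ρ) :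
    ∃ k : ℤ, s * 2 ^ k < ρ := by
  have hs := h𝒟.scale_pos
  obtain ⟨n, hn⟩ := exists_pow_lt_of_lt_one (div_pos hρ hs) (one_half_lt_one (α := ℝ))
  refine ⟨-n, ?_⟩
  rw [lt_div_iff₀ hs] at hn
  simpa [mul_comm] using hn

theorem exists_mem_intermediate_density (hd : d ≠ 0) (h𝒟 : IsDyadicSystem s 𝒟)
    {U : Set (EuclideanSpace ℝ (Fin d))} (hU : IsOpen U) (hUb : Bornology.IsBounded U)
    {x : EuclideanSpace ℝ (Fin d)} (hx : x ∈ U) :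
    ∃ P ∈ 𝒟, x ∈ P.toSet ∧ P.side ^ d ≤ 2 ^ (d + 1) * volume.real (U ∩ P.toSet) ∧
      2 * volume.real (U ∩ P.toSet) ≤ P.side ^ d := by
  choose Q hQ𝒟 hQside hxQ using fun k => (h𝒟.partition k x).exists
  have hbdd : ∃ N : ℤ, ∀ k, (Q k).side ^ d < 2 * volume.real (U ∩ (Q k).toSet) → k ≤ N := by
    obtain ⟨N, hN⟩ := h𝒟.exists_forall_scale_le (max 1 (2 ^ (d + 1) * volume.real U))
    refine ⟨N, fun k hk => hN k ?_⟩
    rw [← hQside k]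
    refine HalfOpenCube.side_le_max_of_pow_le hd hUb (hk.le.trans ?_)
    gcongr
    exact le_self_pow₀ one_le_two (by omega)
  have hne : ∃ k, (Q k).side ^ d < 2 * volume.real (U ∩ (Q k).toSet) := by
    obtain ⟨ρ, hρ, hball⟩ := Metric.isOpen_iff.1 hU x hx
    have hd' : 0 < √(d : ℝ) := Real.sqrt_pos.2 (by positivity)
    obtain ⟨k, hk⟩ := h𝒟.exists_scale_lt (div_pos hρ hd')
    refine ⟨k, ?_⟩
    have hsub : (Q k).toSet ⊆ U := fun y hy => hball <| by
      refine ((Q k).dist_le hy (hxQ k)).trans_lt ?_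
      rw [hQside k, mul_comm]
      exact (lt_div_iff₀ hd').1 hk
    rw [inter_eq_self_of_subset_right hsub, HalfOpenCube.volumeReal_toSet]
    have := pow_pos (Q k).side_pos d
    linarith
  obtain ⟨k, hk, hmax⟩ := Int.exists_greatest_of_bdd hbdd hne
  have hside : (Q (k + 1)).side = 2 * (Q k).side := by
    rw [hQside, hQside, zpow_add_one₀ two_ne_zero]
    ring
  have hsub : (Q k).toSet ⊆ (Q (k + 1)).toSet := by
    rcases h𝒟.nested _ (hQ𝒟 k) _ (hQ𝒟 (k + 1)) with h | h | h
    · exact absurd (hxQ (k + 1)) (disjoint_left.1 h (hxQ k))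
    · exact h
    · have := HalfOpenCube.side_le_side_of_subset hd h
      have := (Q k).side_pos
      linarith
  refine ⟨Q (k + 1), hQ𝒟 _, hxQ _, ?_, ?_⟩
  · have h1 : volume.real (U ∩ (Q k).toSet) ≤ volume.real (U ∩ (Q (k + 1)).toSet) :=
      measureReal_mono (inter_subset_inter_right _ hsub)
        (measure_ne_top_of_subset inter_subset_left hUb.measure_lt_top.ne)
    -- The parent has `2^d` times the volume of a cube filled to more than half, hence the factor
    -- `2^{d+1}`.
    rw [hside, mul_pow, pow_succ, mul_assoc]
    gcongr
    linarith
  · by_contra! h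
    have := hmax _ h
    omega

end IsDyadicSystem

/-! ### Selection of maximal cubes -/

theorem mainTheorem2 (d : ℕ) (hd : 1 ≤ d) :
    ∃ C : ℝ, 0 < C ∧
      ∀ (s : ℝ) (𝒟 : Set (HalfOpenCube d)), IsDyadicSystem s 𝒟 →
      ∀ U : Set (EuclideanSpace ℝ (Fin d)), IsOpen U → Bornology.IsBounded U →
      ∀ Dχ : VectorMeasure (EuclideanSpace ℝ (Fin d)) (EuclideanSpace ℝ (Fin d)),
        IsDistribGradient (U.indicator (fun _ => (1 : ℝ))) Dχ →
      ∃ 𝒬 : Set (HalfOpenCube d), 𝒬 ⊆ 𝒟 ∧ 𝒬.Countable ∧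
        𝒬.PairwiseDisjoint HalfOpenCube.toSet ∧
        U ⊆ ⋃ Q ∈ 𝒬, Q.toSet ∧
        (∀ x, HasSum (fun Q : 𝒬 => (U ∩ Q.1.toSet).indicator (fun _ => (1 : ℝ)) x)
          (U.indicator (fun _ => (1 : ℝ)) x)) ∧
        ∀ Q ∈ 𝒬, Q.side ^ (d - 1) ≤ C * Dχ.variation.real Q.toSet := by
  have hd0 : d ≠ 0 := by omega
  refine ⟨2 ^ (d + 2) * √d ^ (d + 1) *
    volume.real (Metric.ball (0 : EuclideanSpace ℝ (Fin d)) 1), ?_, ?_⟩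
  · have h1 : 0 < volume.real (Metric.ball (0 : EuclideanSpace ℝ (Fin d)) 1) :=
      ENNReal.toReal_pos (Metric.measure_ball_pos _ _ one_pos).ne' measure_ball_lt_top.ne
    have h2 : 0 < √(d : ℝ) := Real.sqrt_pos.2 (by positivity)
    positivity
  intro s 𝒟 h𝒟 U hU hUb Dχ hDχ
  set 𝒢 : Set (HalfOpenCube d) := {P | P ∈ 𝒟 ∧
    P.side ^ d ≤ 2 ^ (d + 1) * volume.real (U ∩ P.toSet) ∧
      2 * volume.real (U ∩ P.toSet) ≤ P.side ^ d}
  set 𝒬 : Set (HalfOpenCube d) := {P | P ∈ 𝒢 ∧ ∀ R ∈ 𝒢, P.toSet ⊆ R.toSet → R = P}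
  have hdisj : 𝒬.PairwiseDisjoint HalfOpenCube.toSet := by
    intro P hP R hR hPR
    rcases h𝒟.nested P hP.1.1 R hR.1.1 with h | h | h
    · exact h
    · exact absurd (hP.2 R hR.1 h).symm hPR
    · exact absurd (hR.2 P hP.1 h) hPR
  have hcover : ∀ x ∈ U, ∃ P ∈ 𝒬, x ∈ P.toSet := by
    intro x hx
    have hne : ∃ k : ℤ, ∃ P ∈ 𝒢, x ∈ P.toSet ∧ P.side = s * 2 ^ k := by
      obtain ⟨P, hP, hxP, h⟩ := h𝒟.exists_mem_intermediate_density hd0 hU hUb hx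
      obtain ⟨k, hk⟩ := h𝒟.side_eq P hP
      exact ⟨k, P, ⟨hP, h⟩, hxP, hk⟩
    have hbdd : ∃ N : ℤ, ∀ k : ℤ, (∃ P ∈ 𝒢, x ∈ P.toSet ∧ P.side = s * 2 ^ k) → k ≤ N := by
      obtain ⟨N, hN⟩ := h𝒟.exists_forall_scale_le (max 1 (2 ^ (d + 1) * volume.real U))
      refine ⟨N, ?_⟩
      rintro k ⟨P, hP, -, hk⟩
      exact hN k (hk ▸ HalfOpenCube.side_le_max_of_pow_le hd0 hUb hP.2.1)
    obtain ⟨k, ⟨P, hP, hxP, hk⟩, hmax⟩ := Int.exists_greatest_of_bdd hbdd hne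
    refine ⟨P, ⟨hP, fun R hR hPR => ?_⟩, hxP⟩
    obtain ⟨l, hl⟩ := h𝒟.side_eq R hR.1
    have hlk := hmax l ⟨R, hR, hPR hxP, hl⟩
    refine h𝒟.eq_of_mem_of_side_eq hR.1 hP.1 (le_antisymm ?_
      (HalfOpenCube.side_le_side_of_subset hd0 hPR)) (hPR hxP) hxP
    rw [hl, hk]
    have := h𝒟.scale_pos
    gcongr
    exact one_le_two
  refine ⟨𝒬, fun P hP => hP.1.1, ?_, hdisj, ?_, ?_, ?_⟩
  · have h1 := Measure.countable_meas_pos_of_disjoint_iUnion (μ := volume)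
      (As := fun P : 𝒬 => P.1.toSet) (fun P => P.1.measurableSet_toSet)
      (fun P R hPR => hdisj P.2 R.2 fun h => hPR (Subtype.ext h))
    have h2 : {P : 𝒬 | 0 < volume P.1.toSet} = univ := by
      refine eq_univ_of_forall fun P => ?_
      have := P.1.side_pos
      simp only [mem_ofPred_eq, HalfOpenCube.volume_toSet, ENNReal.ofReal_pos]
      positivity
    rw [h2, countable_univ_iff] at h1
    exact h1
  · intro x hx
    obtain ⟨P, hP, hxP⟩ := hcover x hx
    exact mem_biUnion hP hxP
  · intro x
    by_cases hx : x ∈ U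
    · obtain ⟨P, hP, hxP⟩ := hcover x hx
      have : U.indicator (fun _ => (1 : ℝ)) x =
          (U ∩ (⟨P, hP⟩ : 𝒬).1.toSet).indicator (fun _ => (1 : ℝ)) x := by
        rw [indicator_of_mem hx, indicator_of_mem (show x ∈ U ∩ P.toSet from ⟨hx, hxP⟩)]
      rw [this]
      refine hasSum_single _ fun R hR => indicator_of_notMem (fun hxR => ?_) _
      exact disjoint_left.1 (hdisj R.2 hP fun h => hR (Subtype.ext h)) hxR.2 hxP
    · simp [hx, hasSum_zero]
  · intro P hP
    exact HalfOpenCube.side_pow_le_variation hd hU hUb hDχ hP.1.2.1 hP.1.2.2
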